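/- Let $\Gamma$ be a finite digraph with vertex set $V$ in which every arc $u\to v$ has a positive real weight. The weight of a subgraph is the product of the weights of its arcs. A bicomponent is a maximal strongly connected subgraph; it is a basis bicomponent if no arc of $\Gamma$ enters it from outside. Let $\widetilde K$ be the union of the vertex sets of all basis bicomponents; for $k\in\widetilde K$ let $K(k)$ be the (unique) basis bicomponent containing $k$, and let $K^+(k)$ be the set of all vertices that are reachable by directed paths (possibly of length zero) from $K(k)$ and unreachable from every other basis bicomponent. A diverging tree is an oriented tree with a root from which directed paths lead to all its vertices. An out-forest of $\Gamma$ is a spanning subgraph of $\Gamma$ that is an oriented forest all of whose weak components are diverging trees; it is a maximum out-forest if it has the largest number of arcs among all out-forests of $\Gamma$. Let $\bar J$ be the normalized matrix of maximum out-forests: $\bar J_{ij}$ is the total weight of the maximum out-forests of $\Gamma$ in which $i$ belongs to a tree diverging from (that is, rooted at) $j$, divided by the total weight of all maximum out-forests of $\Gamma$. Then for all $i,j\in V$: 1. $\bar J_{ii}\ge\bar J_{ji}$; 2. if $\bar J_{ii}>\bar J_{ji}$, then $i\in\widetilde K$, $j\notin K^+(i)$, and $\Gamma$ contains no path from $j$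 to $i$; 3. if $\bar J_{ii}>\bar J_{ji}>0$, then $j\notin\widetilde K$, and $j$ is not a root in any maximum out-forest of $\Gamma$; 4. if $\bar J_{ij}>0$, then $\bar J_{ii}=\bar J_{ji}$. -/

import Mathlib

namespace DigraphForest

/-- `v` is reachable from `u`: there is a directed path (possibly of length zero) from `u` to `v`.
`Γ.Adj u v` means that `Γ` has the arc `u → v`. -/
def Reach {V : Type*} (Γ : Digraph V) (u v : V) : Prop :=
  Relation.ReflTransGen Γ.Adj u v

/-- `K` is a nonempty set of vertices whose induced subdigraph is strongly connected. The paths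
are required to stay inside `K`. -/
def IsStrong {V : Type*} (Γ : Digraph V) (K : Set V) : Prop :=
  K.Nonempty ∧ ∀ u ∈ K, ∀ v ∈ K,
    Relation.ReflTransGen (fun a b => a ∈ K ∧ b ∈ K ∧ Γ.Adj a b) u v

/-- `K` is the vertex set of a bicomponent (strong component): a maximal strong subdigraph. -/
def IsBicomponent {V : Type*} (Γ : Digraph V) (K : Set V) : Prop :=
  Maximal (IsStrong Γ) K

/-- `K` is the vertex set of a basis bicomponent: no arcs flow into it from outside. -/
def IsBasisBicomponent {V : Type*} (Γ : Digraph V) (K : Set V) : Prop :=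
  IsBicomponent Γ K ∧ ∀ u ∉ K, ∀ v ∈ K, ¬ Γ.Adj u v

/-- The union of the vertex sets of all basis bicomponents. -/
def basisVertices {V : Type*} (Γ : Digraph V) : Set V :=
  {v | ∃ K, IsBasisBicomponent Γ K ∧ v ∈ K}

/-- `K⁺`: the vertices reachable from `K` and unreachable from all other basis bicomponents. -/
def exclusivelyReachable {V : Type*} (Γ : Digraph V) (K : Set V) : Set V :=
  {v | (∃ u ∈ K, Reach Γ u v) ∧
    ∀ K', IsBasisBicomponent Γ K' → K' ≠ K → ∀ u ∈ K', ¬ Reach Γ u v}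

/-- The underlying undirected graph. Its connected components are the weak components of `F`. -/
abbrev underlying {V : Type*} (F : Digraph V) : SimpleGraph V :=
  F.toSimpleGraphInclusive

/-- `F` is an oriented forest: it has no loops and no pairs of opposite arcs, and forgetting the
orientation of its arcs yields a forest. -/
def IsOrientedForest {V : Type*} (F : Digraph V) : Prop :=
  (∀ u v, F.Adj u v → ¬ F.Adj v u) ∧ (underlying F).IsAcyclic

/-- `r` is a root of its weak component in `F`: all the vertices of that weak component
are reachable in `F` from `r`. -/
def IsRoot {V : Type*} (F : Digraph V) (r : V) : Prop :=
  ∀ v, (underlying F).Reachable r v → Reach F r v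

/-- `F` is a diverging forest: an oriented forest, each weak component of which is a tree that
diverges from some root. -/
def IsDivergingForest {V : Type*} (F : Digraph V) : Prop :=
  IsOrientedForest F ∧
    ∀ c : (underlying F).ConnectedComponent, ∃ r ∈ c.supp, IsRoot F r

/-- In `F`, the vertex `i` belongs to a tree diverging from `j`. -/
def BelongsToTreeFrom {V : Type*} (F : Digraph V) (i j : V) : Prop :=
  IsRoot F j ∧ (underlying F).Reachable j i

/-- An out-forest of `Γ`: a spanning diverging forest of `Γ`. -/
def IsOutForest {V : Type*} (Γ F : Digraph V) : Prop :=
  F ≤ Γ ∧ IsDivergingForest F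

open Classical in
/-- The finite set of arcs `(u, v)`, meaning `u → v`. -/
noncomputable def arcs {V : Type*} [Fintype V] (F : Digraph V) : Finset (V × V) :=
  Finset.univ.filter fun p => F.Adj p.1 p.2

/-- A maximum out-forest of `Γ`: an out-forest with the largest number of arcs. -/
def IsMaximumOutForest {V : Type*} [Fintype V] (Γ F : Digraph V) : Prop :=
  IsOutForest Γ F ∧ ∀ F' : Digraph V, IsOutForest Γ F' → (arcs F').card ≤ (arcs F).card

/-- The weight of a digraph: the product of the weights of all its arcs, where `w u v` is the
weight of the arc `u → v`. -/
noncomputable def weight {V : Type*} [Fintype V] (w : V → V → ℝ) (F : Digraph V) : ℝ :=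
  ∏ p ∈ arcs F, w p.1 p.2

open Classical in
/-- The total weight of the maximum out-forests of `Γ` that have the property `P`. -/
noncomputable def totalWeight {V : Type*} [Fintype V] (Γ : Digraph V) (w : V → V → ℝ)
    (P : Digraph V → Prop) : ℝ :=
  ∑ F ∈ (Finset.univ : Finset (Digraph V)).filter (fun F => IsMaximumOutForest Γ F ∧ P F),
    weight w F

/-- The normalized matrix of maximum out-forests: the entry `(i, j)` is the total weight of the
maximum out-forests in which `i` belongs to a tree diverging from `j`, divided by the total weight
of all maximum out-forests. -/
noncomputable def normalizedForestMatrix {V : Type*} [Fintype V] (Γ : Digraph V)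
    (w : V → V → ℝ) : Matrix V V ℝ :=
  Matrix.of fun i j =>
    totalWeight Γ w (fun F => BelongsToTreeFrom F i j) / totalWeight Γ w (fun _ => True)

end DigraphForest

/-!
The entries `J j i` and `J i i` sum the same weights over two nested families of maximum
out-forests: those in which `j` lies in the tree of the root `i`, and those in which `i` is a root.
Hence `J j i ≤ J i i`, and a strict inequality produces a maximum out-forest in which `i` is a root
while `j` hangs from a different root `r`. The rest is about which vertices can be roots.

An out-forest has in-degree at most one everywhere and zero at its roots, so its arcs number at
most `|V| - |roots|`. Conversely every dominating set `S` (one from which all vertices are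
reachable) carries an out-forest with at least `|V| - |S|` arcs: let each vertex outside `S` choose
a parent one step nearer to `S`. As the roots of an out-forest dominate, the roots of a *maximum*
out-forest form a dominating set of least cardinality (`card_roots_le_of_isDominating`). No root can
then be dropped, which gives two facts: distinct roots do not reach each other
(`eq_of_isRoot_of_reach`), and whatever reaches a root is reached from it (`reach_of_isRoot`).
The second fact says that the vertices reaching a root form a basis bicomponent.

With `i`, `j`, `r` as above, `i` is therefore in a basis bicomponent, a path from `j` to `i` would
yield one from `r` to `i`, and `j` is reachable from the basis bicomponent of `r`, which is not the
one of `i`. The remaining claims follow because a positive entry `J j i` requires a path from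
`i` to `j`, and such a path can be reversed whenever `j` is a root or lies in a basis bicomponent.
-/

namespace DigraphForest

variable {V : Type*} {Γ F : Digraph V}

/-! ### Reachability in digraphs -/

theorem Reach.mono (h : F ≤ Γ) {u v : V} (huv : Reach F u v) : Reach Γ u v :=
  Relation.ReflTransGen.mono (fun _ _ hab => h hab) u v huv

theorem IsStrong.reach {K : Set V} (hK : IsStrong Γ K) {u v : V} (hu : u ∈ K) (hv : v ∈ K) :
    Reach Γ u v :=
  Relation.ReflTransGen.mono (fun _ _ h => h.2.2) u v (hK.2 u hu v hv)

theorem IsBasisBicomponent.mem_of_reach {K : Set V} (hK : IsBasisBicomponent Γ K) {u v : V}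
    (hv : v ∈ K) (huv : Reach Γ u v) : u ∈ K := by
  induction huv using Relation.ReflTransGen.head_induction_on with
  | refl => exact hv
  | head hab _ ih =>
    by_contra ha
    exact hK.2 _ ha _ ih hab

/-! ### Directed and undirected reachability in oriented forests -/

theorem Reach.underlying {u v : V} (h : Reach F u v) : (underlying F).Reachable u v := by
  induction h with
  | refl => exact SimpleGraph.Reachable.refl _
  | @tail b c _ hbc ih =>
    by_cases hne : b = c
    · exact hne ▸ ih
    · exact ih.trans (SimpleGraph.Adj.reachable ⟨hne, Or.inl hbc⟩)

theorem IsOrientedForest.ne_of_adj (hF : IsOrientedForest F) {u v : V} (h : F.Adj u v) : u ≠ v := by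
  rintro rfl
  exact hF.1 _ _ h h

theorem IsOrientedForest.not_reachable_deleteEdges (hF : IsOrientedForest F) {u v : V}
    (h : F.Adj u v) : ¬ ((underlying F).deleteEdges {s(u, v)}).Reachable u v :=
  SimpleGraph.isAcyclic_iff_forall_adj_isBridge.mp hF.2 ⟨hF.ne_of_adj h, Or.inl h⟩

theorem IsOrientedForest.reachable_deleteEdges_of_adj (hF : IsOrientedForest F) {u v a b : V}
    (h : F.Adj a b) (hne : s(a, b) ≠ s(u, v)) :
    ((underlying F).deleteEdges {s(u, v)}).Reachable a b := by
  apply SimpleGraph.Adj.reachable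
  rw [SimpleGraph.deleteEdges_adj]
  exact ⟨⟨hF.ne_of_adj h, Or.inl h⟩, hne⟩

/-- An oriented forest has no directed cycle: a directed path from `v` to `u` would avoid the edge
of an arc `u → v`, which is a bridge. -/
theorem IsOrientedForest.not_adj_of_reach (hF : IsOrientedForest F) {u v : V} (h : Reach F v u) :
    ¬ F.Adj u v := by
  intro huv
  have key : ∀ x, Reach F v x → ((underlying F).deleteEdges {s(u, v)}).Reachable v x := by
    intro x hx
    induction hx with
    | refl => exact SimpleGraph.Reachable.refl _
    | @tail b c _ hbc ih =>
      by_cases he : s(b, c) = s(u, v)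
      · rcases Sym2.eq_iff.mp he with ⟨rfl, rfl⟩ | ⟨rfl, rfl⟩
        · exact SimpleGraph.Reachable.refl _
        · exact absurd huv (hF.1 _ _ hbc)
      · exact ih.trans (hF.reachable_deleteEdges_of_adj hbc he)
  exact hF.not_reachable_deleteEdges huv (key u h).symm

/-- The root of its component has in-degree zero. -/
theorem IsOrientedForest.not_adj_of_isRoot (hF : IsOrientedForest F) {u r : V} (hr : IsRoot F r) :
    ¬ F.Adj u r := fun h =>
  hF.not_adj_of_reach (hr u (Reach.underlying (Relation.ReflTransGen.single h)).symm) h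

theorem IsDivergingForest.exists_isRoot_reach (hF : IsDivergingForest F) (v : V) :
    ∃ r, IsRoot F r ∧ Reach F r v := by
  obtain ⟨r, hr, hroot⟩ := hF.2 ((underlying F).connectedComponentMk v)
  exact ⟨r, hroot, hroot v (SimpleGraph.ConnectedComponent.exact hr)⟩

/-- In a diverging forest all in-degrees are at most one: otherwise two paths from the root, ending
in different arcs into `v`, would close a cycle in the underlying graph. -/
theorem IsDivergingForest.eq_of_adj_of_adj (hF : IsDivergingForest F) {u u' v : V}
    (h : F.Adj u v) (h' : F.Adj u' v) : u = u' := by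
  by_contra hne
  obtain ⟨r, hr, hru⟩ := hF.exists_isRoot_reach u
  have huv : (underlying F).Reachable u v := Reach.underlying (Relation.ReflTransGen.single h)
  have hu'v : (underlying F).Reachable u' v := Reach.underlying (Relation.ReflTransGen.single h')
  have hru' : Reach F r u' := hr u' ((hru.underlying.trans huv).trans hu'v.symm)
  have key : ∀ x, Reach F r x →
      ((underlying F).deleteEdges {s(u, v)}).Reachable r x ∨ Reach F v x := by
    intro x hx
    induction hx with
    | refl => exact Or.inl (SimpleGraph.Reachable.refl _)
    | @tail b c _ hbc ih =>
      rcases ih with ih | ih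
      · by_cases he : s(b, c) = s(u, v)
        · rcases Sym2.eq_iff.mp he with ⟨rfl, rfl⟩ | ⟨rfl, rfl⟩
          · exact Or.inr Relation.ReflTransGen.refl
          · exact absurd h (hF.1.1 _ _ hbc)
        · exact Or.inl (ih.trans (hF.1.reachable_deleteEdges_of_adj hbc he))
      · exact Or.inr (ih.tail hbc)
  have h1 := (key u hru).resolve_right fun hvu => hF.1.not_adj_of_reach hvu h
  have h2 := (key u' hru').resolve_right fun hvu => hF.1.not_adj_of_reach hvu h'
  have h3 : ((underlying F).deleteEdges {s(u, v)}).Reachable u' v := by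
    apply hF.1.reachable_deleteEdges_of_adj h'
    intro he
    rcases Sym2.eq_iff.mp he with ⟨hu, _⟩ | ⟨_, hu⟩
    · exact hne hu.symm
    · exact hF.1.ne_of_adj h hu.symm
  exact hF.1.not_reachable_deleteEdges h ((h1.symm.trans h2).trans h3)

theorem BelongsToTreeFrom.reach (hle : F ≤ Γ) {i j : V} (h : BelongsToTreeFrom F i j) :
    Reach Γ j i :=
  (h.1 i h.2).mono hle

/-! ### Diverging forests from a depth function -/

/-- Descendants are closed under undirected adjacency, except through an arc into the top vertex:
if all in-degrees are at most one and `x` is a descendant of `a`, then so is each neighbour `y` of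
`x`, unless `x = a` and `y` is its parent. -/
theorem reach_or_of_underlying_adj (hp : ∀ u u' v, F.Adj u v → F.Adj u' v → u = u') {a x y : V}
    (hx : Reach F a x) (hxy : (underlying F).Adj x y) : Reach F a y ∨ (x = a ∧ F.Adj y x) := by
  rcases hxy.2 with h | h
  · exact Or.inl (hx.tail h)
  · rcases Relation.ReflTransGen.cases_tail hx with rfl | ⟨z, haz, hzx⟩
    · exact Or.inr ⟨rfl, h⟩
    · exact Or.inl (hp _ _ _ h hzx ▸ haz)

theorem depth_le_of_reach {d : V → ℕ} (hd : ∀ u v, F.Adj u v → d u < d v) {u v : V}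
    (h : Reach F u v) : d u ≤ d v := by
  induction h with
  | refl => exact le_rfl
  | tail _ hbc ih => exact ih.trans (hd _ _ hbc).le

theorem isDivergingForest_of_depth (d : V → ℕ) (hd : ∀ u v, F.Adj u v → d u < d v)
    (hp : ∀ u u' v, F.Adj u v → F.Adj u' v → u = u') : IsDivergingForest F := by
  refine ⟨⟨fun u v h h' => (hd _ _ h).not_gt (hd _ _ h'), ?_⟩, ?_⟩
  · -- The edge of an arc `u → v` is a bridge, as without it the descendants of `v` are closed
    -- under adjacency, and `u` is not one of them.
    have bridge : ∀ u v, F.Adj u v →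
        ¬ ((underlying F).deleteEdges {s(u, v)}).Reachable v u := by
      intro u v huv h
      rw [SimpleGraph.reachable_iff_reflTransGen] at h
      have key : ∀ x, Relation.ReflTransGen ((underlying F).deleteEdges {s(u, v)}).Adj v x →
          Reach F v x := by
        intro x hx
        induction hx with
        | refl => exact Relation.ReflTransGen.refl
        | @tail b c _ hbc ih =>
          rw [SimpleGraph.deleteEdges_adj] at hbc
          refine (reach_or_of_underlying_adj hp ih hbc.1).resolve_right ?_
          rintro ⟨rfl, hcb⟩
          exact hbc.2 (hp _ _ _ hcb huv ▸ Sym2.eq_swap)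
      exact (hd _ _ huv).not_ge (depth_le_of_reach hd (key u h))
    rw [SimpleGraph.isAcyclic_iff_forall_adj_isBridge]
    intro u v huv
    rw [SimpleGraph.isBridge_iff]
    rcases huv.2 with h | h
    · exact fun hr => bridge u v h hr.symm
    · rw [Sym2.eq_swap]
      exact bridge v u h
  · -- A vertex of least depth in a weak component has no parent, hence is a root.
    intro c
    obtain ⟨r, hrc, hmin⟩ := (measure d).wf.has_min c.supp c.nonempty_supp
    refine ⟨r, hrc, fun v hv => ?_⟩
    rw [SimpleGraph.reachable_iff_reflTransGen] at hv
    induction hv with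
    | refl => exact Relation.ReflTransGen.refl
    | @tail x y _ hxy ih =>
      refine (reach_or_of_underlying_adj hp ih hxy).resolve_right ?_
      rintro ⟨rfl, hyx⟩
      exact hmin y (c.mem_supp_of_adj_mem_supp hrc hxy) (hd _ _ hyx)

/-! ### Dominating sets and the number of arcs -/

/-- Every vertex of `Γ` is reachable from some element of `S`. -/
def IsDominating (Γ : Digraph V) (S : Set V) : Prop :=
  ∀ v, ∃ r ∈ S, Reach Γ r v

theorem IsOutForest.isDominating (hF : IsOutForest Γ F) : IsDominating Γ {r | IsRoot F r} :=
  fun v =>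
    let ⟨r, hr, hrv⟩ := hF.2.exists_isRoot_reach v
    ⟨r, hr, hrv.mono hF.1⟩

theorem IsDominating.diff_singleton {S : Set V} (hS : IsDominating Γ S) {r s : V} (hs : s ∈ S)
    (hne : s ≠ r) (hsr : Reach Γ s r) : IsDominating Γ (S \ {r}) := by
  intro v
  obtain ⟨t, ht, htv⟩ := hS v
  by_cases h : t = r
  · exact ⟨s, ⟨hs, hne⟩, hsr.trans (h ▸ htv)⟩
  · exact ⟨t, ⟨ht, h⟩, htv⟩

/-- The vertices at distance at most `n` from `S`. -/
def withinDistance (Γ : Digraph V) (S : Set V) : ℕ → Set V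
  | 0 => S
  | n + 1 => withinDistance Γ S n ∪ {v | ∃ u ∈ withinDistance Γ S n, Γ.Adj u v}

/-- The distance from a dominating set: every vertex outside the set has an in-neighbour at a
smaller distance. -/
theorem IsDominating.exists_depth {S : Set V} (hS : IsDominating Γ S) :
    ∃ d : V → ℕ, ∀ v ∉ S, ∃ u, Γ.Adj u v ∧ d u < d v := by
  classical
  have hex : ∀ v, ∃ n, v ∈ withinDistance Γ S n := by
    intro v
    obtain ⟨r, hr, hrv⟩ := hS v
    induction hrv with
    | refl => exact ⟨0, hr⟩
    | @tail b c _ hbc ih =>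
      obtain ⟨n, hn⟩ := ih
      exact ⟨n + 1, Or.inr ⟨b, hn, hbc⟩⟩
  refine ⟨fun v => Nat.find (hex v), fun v hv => ?_⟩
  have hspec := Nat.find_spec (hex v)
  have hmin := @Nat.find_min _ _ (hex v)
  revert hspec hmin
  beta_reduce
  generalize Nat.find (hex v) = n
  intro hspec hmin
  cases n with
  | zero => exact absurd hspec hv
  | succ m =>
    rcases hspec with h | ⟨u, hu, huv⟩
    · exact absurd h (hmin m.lt_succ_self)
    · exact ⟨u, huv, Nat.lt_succ_of_le (Nat.find_min' (hex u) hu)⟩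

variable [Fintype V]

theorem mem_arcs {p : V × V} : p ∈ arcs F ↔ F.Adj p.1 p.2 := by
  simp [arcs]

theorem IsDivergingForest.card_arcs_add_card_roots_le (hF : IsDivergingForest F) :
    (arcs F).card + {r | IsRoot F r}.ncard ≤ Fintype.card V := by
  classical
  have h : (arcs F).card ≤ ({r | IsRoot F r}ᶜ : Set V).ncard := by
    rw [Set.ncard_eq_toFinset_card']
    refine Finset.card_le_card_of_injOn Prod.snd ?_ ?_
    · intro p hp
      simp only [Set.coe_toFinset, Set.mem_compl_iff, Set.mem_ofPred_eq]
      exact fun hr => hF.1.not_adj_of_isRoot hr (mem_arcs.mp hp)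
    · intro p hp q hq hpq
      have hp := mem_arcs.mp hp
      have hq := mem_arcs.mp hq
      exact Prod.ext (hF.eq_of_adj_of_adj hp (hpq ▸ hq)) hpq
  have := Set.ncard_add_ncard_compl {r | IsRoot F r}
  rw [Nat.card_eq_fintype_card] at this
  lia

/-- A dominating set `S` carries an out-forest in which every vertex outside `S` has a parent. -/
theorem IsDominating.exists_isOutForest {S : Set V} (hS : IsDominating Γ S) :
    ∃ F, IsOutForest Γ F ∧ Fintype.card V ≤ (arcs F).card + S.ncard := by
  classical
  obtain ⟨d, hd⟩ := hS.exists_depth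
  choose! p hp hdp using hd
  refine ⟨⟨fun u v => v ∉ S ∧ u = p v⟩, ⟨?_, ?_⟩, ?_⟩
  · rintro u v ⟨hv, rfl⟩
    exact hp v hv
  · refine isDivergingForest_of_depth d ?_ ?_
    · rintro u v ⟨hv, rfl⟩
      exact hdp v hv
    · rintro u u' v ⟨-, rfl⟩ ⟨-, rfl⟩
      rfl
  · have h : (Sᶜ : Set V).ncard ≤ (arcs (⟨fun u v => v ∉ S ∧ u = p v⟩ : Digraph V)).card := by
      rw [Set.ncard_eq_toFinset_card']
      refine Finset.card_le_card_of_injOn (fun v => (p v, v)) ?_ ?_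
      · intro v hv
        exact mem_arcs.mpr ⟨by simpa using hv, rfl⟩
      · intro v _ v' _ h
        exact congrArg Prod.snd h
    have := Set.ncard_add_ncard_compl S
    rw [Nat.card_eq_fintype_card] at this
    lia

/-! ### Roots of maximum out-forests -/

theorem IsMaximumOutForest.card_roots_le_of_isDominating (hF : IsMaximumOutForest Γ F) {S : Set V}
    (hS : IsDominating Γ S) : {r | IsRoot F r}.ncard ≤ S.ncard := by
  obtain ⟨F', hF', hcard⟩ := hS.exists_isOutForest
  have h1 := hF.2 F' hF'
  have h2 := hF.1.2.card_arcs_add_card_roots_le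
  lia

theorem IsMaximumOutForest.eq_of_isRoot_of_reach (hF : IsMaximumOutForest Γ F) {r s : V}
    (hr : IsRoot F r) (hs : IsRoot F s) (hsr : Reach Γ s r) : s = r := by
  by_contra hne
  have h := hF.card_roots_le_of_isDominating (hF.1.isDominating.diff_singleton hs hne hsr)
  exact h.not_gt (Set.ncard_sdiff_singleton_lt_of_mem hr)

theorem IsMaximumOutForest.reach_of_isRoot (hF : IsMaximumOutForest Γ F) {r u : V}
    (hr : IsRoot F r) (hur : Reach Γ u r) : Reach Γ r u := by
  obtain ⟨s, hs, hsu⟩ := hF.1.isDominating u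
  exact hF.eq_of_isRoot_of_reach hr hs (hsu.trans hur) ▸ hsu

theorem IsMaximumOutForest.isBasisBicomponent (hF : IsMaximumOutForest Γ F) {r : V}
    (hr : IsRoot F r) : IsBasisBicomponent Γ {u | Reach Γ u r} := by
  refine ⟨⟨⟨⟨r, Relation.ReflTransGen.refl⟩, ?_⟩, ?_⟩, ?_⟩
  · intro u hu v hv
    have huv : Reach Γ u v := Relation.ReflTransGen.trans hu (hF.reach_of_isRoot hr hv)
    -- All vertices of a path to `v` reach `r`, so the path stays inside the set.
    induction huv using Relation.ReflTransGen.head_induction_on with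
    | refl => exact Relation.ReflTransGen.refl
    | @head a b hab hbv ih =>
      have hb : Reach Γ b r := Relation.ReflTransGen.trans hbv hv
      exact Relation.ReflTransGen.head ⟨hu, hb, hab⟩ (ih hb)
  · intro K' hK' hle x hx
    exact hK'.reach hx (hle Relation.ReflTransGen.refl)
  · intro u hu v hv huv
    exact hu (Relation.ReflTransGen.head huv hv)

/-! ### Total weights of maximum out-forests -/

theorem weight_nonneg {w : V → V → ℝ} (hw : ∀ u v, Γ.Adj u v → 0 < w u v) (h : F ≤ Γ) :
    0 ≤ weight w F :=
  Finset.prod_nonneg fun _ hp => (hw _ _ (h (mem_arcs.mp hp))).le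

theorem totalWeight_nonneg {w : V → V → ℝ} (hw : ∀ u v, Γ.Adj u v → 0 < w u v)
    (P : Digraph V → Prop) : 0 ≤ totalWeight Γ w P := by
  classical
  exact Finset.sum_nonneg fun F hF => weight_nonneg hw (Finset.mem_filter.mp hF).2.1.1.1

theorem totalWeight_mono {w : V → V → ℝ} (hw : ∀ u v, Γ.Adj u v → 0 < w u v)
    {P Q : Digraph V → Prop} (h : ∀ F, IsMaximumOutForest Γ F → P F → Q F) :
    totalWeight Γ w P ≤ totalWeight Γ w Q := by
  classical
  refine Finset.sum_le_sum_of_subset_of_nonneg ?_ ?_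
  · intro F hF
    simp only [Finset.mem_filter] at hF ⊢
    exact ⟨hF.1, hF.2.1, h F hF.2.1 hF.2.2⟩
  · intro F hF _
    exact weight_nonneg hw (Finset.mem_filter.mp hF).2.1.1.1

theorem normalizedForestMatrix_le {w : V → V → ℝ} (hw : ∀ u v, Γ.Adj u v → 0 < w u v)
    {i j k l : V} (h : ∀ F, IsMaximumOutForest Γ F → BelongsToTreeFrom F i j →
      BelongsToTreeFrom F k l) :
    normalizedForestMatrix Γ w i j ≤ normalizedForestMatrix Γ w k l :=
  div_le_div_of_nonneg_right (totalWeight_mono hw h) (totalWeight_nonneg hw _)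

theorem exists_belongsToTreeFrom_of_pos {w : V → V → ℝ} {i j : V}
    (h : 0 < normalizedForestMatrix Γ w i j) :
    ∃ F, IsMaximumOutForest Γ F ∧ BelongsToTreeFrom F i j := by
  classical
  by_contra! hno
  have h0 : totalWeight Γ w (fun F => BelongsToTreeFrom F i j) = 0 :=
    Finset.sum_eq_zero fun F hF =>
      absurd (Finset.mem_filter.mp hF).2.2 (hno F (Finset.mem_filter.mp hF).2.1)
  simp [normalizedForestMatrix, h0] at h

/-- If `J j i < J i i`, then some maximum out-forest has `i` as a root and `j` in the tree of
another root `r`. -/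
theorem exists_isRoot_ne_of_lt {w : V → V → ℝ} (hw : ∀ u v, Γ.Adj u v → 0 < w u v) {i j : V}
    (h : normalizedForestMatrix Γ w j i < normalizedForestMatrix Γ w i i) :
    ∃ F r, IsMaximumOutForest Γ F ∧ IsRoot F i ∧ IsRoot F r ∧ r ≠ i ∧ Reach Γ r j := by
  by_contra! hno
  refine h.not_ge (normalizedForestMatrix_le hw fun F hF hi => ⟨hi.1, ?_⟩)
  obtain ⟨r, hr, hrj⟩ := hF.1.2.exists_isRoot_reach j
  by_cases hri : r = i
  · exact hri ▸ hrj.underlying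
  · exact absurd (hrj.mono hF.1.1) (hno F r hF hi.1 hr hri)

theorem not_reach_of_lt {w : V → V → ℝ} (hw : ∀ u v, Γ.Adj u v → 0 < w u v) {i j : V}
    (h : normalizedForestMatrix Γ w j i < normalizedForestMatrix Γ w i i) : ¬ Reach Γ j i := by
  obtain ⟨F, r, hF, hi, hr, hne, hrj⟩ := exists_isRoot_ne_of_lt hw h
  exact fun hji => hne (hF.eq_of_isRoot_of_reach hi hr (hrj.trans hji))

end DigraphForest

open DigraphForest in
theorem theorem3 {V : Type*} [Fintype V] (Γ : Digraph V) (w : V → V → ℝ)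
    (hw : ∀ u v, Γ.Adj u v → 0 < w u v) (J : Matrix V V ℝ)
    (hJ : J = DigraphForest.normalizedForestMatrix Γ w) (i j : V) :
    J j i ≤ J i i ∧
    (J j i < J i i →
      i ∈ DigraphForest.basisVertices Γ ∧
      (∀ K, DigraphForest.IsBasisBicomponent Γ K → i ∈ K →
        j ∉ DigraphForest.exclusivelyReachable Γ K) ∧
      ¬ DigraphForest.Reach Γ j i) ∧
    (J j i < J i i → 0 < J j i →
      j ∉ DigraphForest.basisVertices Γ ∧
      ∀ F, DigraphForest.IsMaximumOutForest Γ F → ¬ DigraphForest.IsRoot F j) ∧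
    (0 < J i j → J i i = J j i) := by
  subst hJ
  have hle : normalizedForestMatrix Γ w j i ≤ normalizedForestMatrix Γ w i i :=
    normalizedForestMatrix_le hw fun F _ h => ⟨h.1, SimpleGraph.Reachable.refl _⟩
  refine ⟨hle, fun h => ⟨?_, ?_, not_reach_of_lt hw h⟩, fun h hpos => ?_, fun hpos => ?_⟩
  · obtain ⟨F, r, hF, hi, -⟩ := exists_isRoot_ne_of_lt hw h
    exact ⟨_, hF.isBasisBicomponent hi, Relation.ReflTransGen.refl⟩
  · intro K hK hiK hjK
    obtain ⟨F, r, hF, hi, hr, hne, hrj⟩ := exists_isRoot_ne_of_lt hw h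
    by_cases hKr : {u | Reach Γ u r} = K
    · have hir : Reach Γ i r := by
        rw [← hKr] at hiK
        exact hiK
      exact hne (hF.eq_of_isRoot_of_reach hr hi hir).symm
    · exact hjK.2 _ (hF.isBasisBicomponent hr) hKr r Relation.ReflTransGen.refl hrj
  · obtain ⟨F, hF, hji⟩ := exists_belongsToTreeFrom_of_pos hpos
    have hij : Reach Γ i j := hji.reach hF.1.1
    refine ⟨?_, fun G hG hj => not_reach_of_lt hw h (hG.reach_of_isRoot hj hij)⟩
    rintro ⟨K, hK, hjK⟩
    exact not_reach_of_lt hw h (hK.1.1.reach hjK (hK.mem_of_reach hjK hij))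
  · obtain ⟨F, hF, hij⟩ := exists_belongsToTreeFrom_of_pos hpos
    by_contra hne
    exact not_reach_of_lt hw (lt_of_le_of_ne hle (Ne.symm hne)) (hij.reach hF.1.1)
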